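/- Let $W:[0,1]^2\to[0,1]$ be a graphon, i.e. a measurable function (not assumed symmetric), that is not almost everywhere zero. Write $\|Y\|_{\mathrm F}=\big(\iint_{[0,1]^2} Y(x,y)^2\,dx\,dy\big)^{1/2}$ and $\|Y\|_\square=\sup_{U,V}\big|\int_U\int_V Y(x,y)\,dx\,dy\big|$, the supremum being over measurable $U,V\subseteq[0,1]$. A singular triplet of $W$ is $(\sigma,u,v)$ with $\sigma\in\mathbb R$ and unit vectors $u,v\in L^2[0,1]$ such that $\int_0^1 W(x,y)v(y)\,dy=\sigma u(x)$ for a.e. $x$ and $\int_0^1 W(x,y)u(x)\,dx=\sigma v(y)$ for a.e. $y$ (so $u$ and $v$ are eigenvectors of $WW^\top$ and $W^\top W$ with eigenvalue $\sigma^2$). Singular triplets $(\sigma_k,u_k,v_k)_{k=1}^m$ are called $m$ leading singular triplets of $W$ if $u_1,\dots,u_m$ are orthonormal, $v_1,\dots,v_m$ are orthonormal, $|\sigma_1|\ge\dots\ge|\sigma_m|$, and every singular triplet $(\tau,f,g)$ with $f\perp u_k$ and $g\perp v_k$ for all $k$ satisfies $|\tau|\le|\sigma_k|$ for all $k$. Then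 $m$ leading singular triplets of $W$ exist for every $m\in\mathbb N$. Moreover, let $K\ge 1$ be an integer, let $R\ge1$ be a real number with $K/R\in\mathbb N$, and let $m$ be sampled uniformly from $[K]=\{1,\dots,K\}$. Then with probability at least $1-\frac1R$ over the choice of $m$, for every choice of $m$ leading singular triplets $(\sigma_k,u_k,v_k)_{k=1}^m$ of $W$, the function $C^*(x,y)=\sum_{k=1}^m\sigma_k u_k(x)v_k(y)$ satisfies \[ \|W-C^*\|_\square<\|W\|_{\mathrm F}\sqrt{\frac RK}. \] -/

import Mathlib

open MeasureTheory ProbabilityTheory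

noncomputable section

/-- A (not necessarily symmetric) graphon: a measurable function `[0,1]² → [0,1]`. -/
structure Graphon where
  /-- the underlying function -/
  toFun : unitInterval × unitInterval → ℝ
  measurable_toFun : Measurable toFun
  mem_Icc : ∀ p, toFun p ∈ Set.Icc (0 : ℝ) 1

/-- The real Hilbert space `L²[0,1]`. -/
abbrev L2I : Type := Lp ℝ 2 (volume : Measure unitInterval)

/-- The Frobenius norm `(∬ Y(x,y)² dx dy)^(1/2)`. -/
def frobeniusNorm (Y : unitInterval × unitInterval → ℝ) : ℝ :=
  Real.sqrt (∫ p, Y p ^ 2)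

/-- The cut norm: the supremum of `|∫_U ∫_V Y(x,y) dx dy|` over all measurable
`U, V ⊆ [0,1]`. (For integrable `Y` this set of reals is bounded by `∬ |Y|`.) -/
def cutNorm (Y : unitInterval × unitInterval → ℝ) : ℝ :=
  sSup {r : ℝ | ∃ U V : Set unitInterval, MeasurableSet U ∧ MeasurableSet V ∧
    r = |∫ p in U ×ˢ V, Y p|}

/-- `(σ, u, v)` is a singular triplet of the integral operator with kernel `W`:
`u, v` are unit vectors with `W v = σ u` and `Wᵀ u = σ v`. In particular `u` is an eigenvector
of `W Wᵀ` and `v` one of `Wᵀ W`, both with eigenvalue `σ²`. The sign of `σ` is free. -/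
structure IsSingularTriplet (W : Graphon) (σ : ℝ) (u v : L2I) : Prop where
  norm_left : ‖u‖ = 1
  norm_right : ‖v‖ = 1
  apply_right : ∀ᵐ x : unitInterval, ∫ y : unitInterval, W.toFun (x, y) * v y = σ * u x
  apply_left : ∀ᵐ y : unitInterval, ∫ x : unitInterval, W.toFun (x, y) * u x = σ * v y

/-- `(σ_k, u_k, v_k)`, `k < m`, are `m` leading singular triplets of `W`: they are singular
triplets with orthonormal left and right vectors, ordered by magnitude, and every singular
triplet orthogonal to them has a singular value of at most their magnitude. -/
structure IsLeadingSingularTriplets (W : Graphon) {m : ℕ} (σ : Fin m → ℝ) (u v : Fin m → L2I) :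
    Prop where
  triplet : ∀ k, IsSingularTriplet W (σ k) (u k) (v k)
  orthonormal_left : Orthonormal ℝ u
  orthonormal_right : Orthonormal ℝ v
  antitone : ∀ i j, i ≤ j → |σ j| ≤ |σ i|
  leading : ∀ (τ : ℝ) (f g : L2I), IsSingularTriplet W τ f g →
    (∀ k, inner ℝ (u k) f = 0) → (∀ k, inner ℝ (v k) g = 0) → ∀ k, |τ| ≤ |σ k|

/-- The kernel `(x, y) ↦ ∑ₖ σ_k u_k(x) v_k(y)`. -/
def svdKernel {m : ℕ} (σ : Fin m → ℝ) (u v : Fin m → L2I) :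
    unitInterval × unitInterval → ℝ :=
  fun p => ∑ k, σ k * u k p.1 * v k p.2

end

/-!
Let `T` be the integral operator with kernel `W`. Subtracting `∑ₖ σₖ uₖ ⊗ vₖ` from `T` for singular
triplets with orthonormal `uₖ` and orthonormal `vₖ` leaves a compact operator that agrees with `T`
on the orthogonal complement of the `vₖ` and whose range is orthogonal to the `uₖ`. Hence its norm
`τ` is a singular value of `T`, attained orthogonally to the given triplets. This `τ` extends `m`
leading triplets to `m + 1`, and it satisfies `τ ≤ |σₖ|` for all `k`, so
`(m + 1) * τ² ≤ ∑ₖ σₖ² + τ² ≤ ‖W‖_F²` by the Hilbert–Schmidt bound. The cut norm of `W - C*` is at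
most `τ`, since indicators of subsets of `[0,1]` have `L²` norm at most `1`, and
`τ < ‖W‖_F * √(R / K)` as soon as `K / R < m + 1`, which fails for at most `K / R` of the `m ∈ [K]`.
-/

open scoped InnerProductSpace InnerProduct ENNReal

section Operators

variable {𝕜 E F ι : Type*} [RCLike 𝕜] [NormedAddCommGroup E] [InnerProductSpace 𝕜 E]
  [NormedAddCommGroup F] [InnerProductSpace 𝕜 F]

theorem orthonormal_fin_snoc {n : ℕ} {e : Fin n → E} (he : Orthonormal 𝕜 e) {x : E} (hx : ‖x‖ = 1)
    (hex : ∀ i, ⟪e i, x⟫_𝕜 = 0) : Orthonormal 𝕜 (Fin.snoc e x : Fin (n + 1) → E) := by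
  have hxe : ∀ i, ⟪x, e i⟫_𝕜 = 0 := fun i => inner_eq_zero_symm.mp (hex i)
  rw [orthonormal_iff_ite] at he ⊢
  simp [Fin.forall_fin_succ', he, hex, hxe, hx, inner_self_eq_norm_sq_to_K,
    (Fin.castSucc_ne_last _).symm]

theorem exists_norm_eq_one_forall_inner_eq_zero [Finite ι] (hE : ¬ FiniteDimensional 𝕜 E)
    (e : ι → E) : ∃ x : E, ‖x‖ = 1 ∧ ∀ i, ⟪e i, x⟫_𝕜 = 0 := by
  have hfin : FiniteDimensional 𝕜 (Submodule.span 𝕜 (Set.range e)) :=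
    FiniteDimensional.span_of_finite 𝕜 (Set.finite_range e)
  have hne : (Submodule.span 𝕜 (Set.range e))ᗮ ≠ ⊥ := fun h => by
    rw [Submodule.orthogonal_eq_bot_iff] at h
    rw [h] at hfin
    exact hE Submodule.topEquiv.finiteDimensional
  obtain ⟨y, hy, hy0⟩ := Submodule.exists_mem_ne_zero_of_ne_bot hne
  refine ⟨(‖y‖⁻¹ : 𝕜) • y, norm_smul_inv_norm hy0, fun i => ?_⟩
  rw [inner_smul_right, hy _ (Submodule.subset_span ⟨i, rfl⟩), mul_zero]

section HilbertSchmidt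

/-- `C` bounds the Hilbert–Schmidt norm of `T`. Quantifying over finite orthonormal systems avoids
the choice of a Hilbert basis. -/
def IsHilbertSchmidtBound (T : E →L[𝕜] F) (C : ℝ) : Prop :=
  ∀ ⦃n : ℕ⦄ (e : Fin n → E), Orthonormal 𝕜 e → ∑ i, ‖T (e i)‖ ^ 2 ≤ C ^ 2

namespace IsHilbertSchmidtBound

variable {T : E →L[𝕜] F} {C : ℝ}

theorem exists_orthonormal_forall_norm_apply_le (hT : IsHilbertSchmidtBound T C) {ε : ℝ}
    (hε : 0 < ε) : ∃ (n : ℕ) (e : Fin n → E), Orthonormal 𝕜 e ∧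
      ∀ x, (∀ i, ⟪e i, x⟫_𝕜 = 0) → ‖T x‖ ≤ ε * ‖x‖ := by
  by_contra! hext
  have hlarge (n : ℕ) : ∃ e : Fin n → E, Orthonormal 𝕜 e ∧ ∀ i, ε < ‖T (e i)‖ := by
    induction n with
    | zero => exact ⟨Fin.elim0, ⟨(·.elim0), (·.elim0)⟩, (·.elim0)⟩
    | succ n ih =>
      obtain ⟨e, he, hTe⟩ := ih
      obtain ⟨x, hex, hTx⟩ := hext n e he
      have hx0 : x ≠ 0 := by rintro rfl; simp at hTx
      have hTx' : ε < ‖T ((‖x‖⁻¹ : 𝕜) • x)‖ := by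
        rwa [map_smul, norm_smul, norm_inv, RCLike.norm_ofReal, abs_norm,
          lt_inv_mul_iff₀' (norm_pos_iff.mpr hx0)]
      refine ⟨Fin.snoc e ((‖x‖⁻¹ : 𝕜) • x), orthonormal_fin_snoc he (norm_smul_inv_norm hx0)
        fun i => by rw [inner_smul_right, hex, mul_zero], ?_⟩
      simpa only [Fin.forall_fin_succ', Fin.snoc_castSucc, Fin.snoc_last] using ⟨hTe, hTx'⟩
  obtain ⟨n, hn⟩ := exists_nat_gt (C ^ 2 / ε ^ 2)
  obtain ⟨e, he, hTe⟩ := hlarge n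
  have hsum : n * ε ^ 2 ≤ ∑ i, ‖T (e i)‖ ^ 2 := by
    simpa using Finset.card_nsmul_le_sum Finset.univ (fun i => ‖T (e i)‖ ^ 2) (ε ^ 2)
      fun i _ => pow_le_pow_left₀ hε.le (hTe i).le 2
  exact ((div_lt_iff₀ (by positivity)).mp hn).not_ge (hsum.trans (hT e he))

theorem isCompactOperator [CompleteSpace F] (hT : IsHilbertSchmidtBound T C) :
    IsCompactOperator T := by
  refine isClosed_setOfPred_isCompactOperator.closure_subset
    (Metric.mem_closure_iff.mpr fun ε hε => ?_)
  obtain ⟨n, e, -, hTe⟩ := hT.exists_orthonormal_forall_norm_apply_le (half_pos hε)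
  set U := Submodule.span 𝕜 (Set.range e)
  have hU : FiniteDimensional 𝕜 U := FiniteDimensional.span_of_finite 𝕜 (Set.finite_range e)
  refine ⟨T ∘L U.starProjection, ?_, ?_⟩
  · exact (isCompactOperator_of_locallyCompactSpace_dom U.orthogonalProjectionOnto).clm_comp
      (T ∘L U.subtypeL)
  rw [dist_eq_norm]
  refine lt_of_le_of_lt (ContinuousLinearMap.opNorm_le_bound _ (half_pos hε).le fun x => ?_)
    (half_lt_self hε)
  have horth (i) : ⟪e i, x - U.starProjection x⟫_𝕜 = 0 :=
    U.sub_starProjection_mem_orthogonal x _ (Submodule.subset_span ⟨i, rfl⟩)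
  have hle : ‖x - U.starProjection x‖ ≤ ‖x‖ := by
    simpa [Submodule.starProjection_orthogonal] using Uᗮ.norm_starProjection_apply_le x
  calc ‖(T - T ∘L U.starProjection) x‖ = ‖T (x - U.starProjection x)‖ := by simp
    _ ≤ ε / 2 * ‖x - U.starProjection x‖ := hTe _ horth
    _ ≤ ε / 2 * ‖x‖ := by gcongr

end IsHilbertSchmidtBound

end HilbertSchmidt

section Residual

variable [Fintype ι]

/-- The error `T - ∑ₖ σₖ ⟪vₖ, ·⟫ uₖ` of a finite-rank approximation of `T` in the shape of a
singular value decomposition. -/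
noncomputable def svdResidual (T : E →L[𝕜] F) (σ : ι → 𝕜) (u : ι → F) (v : ι → E) : E →L[𝕜] F :=
  T - ∑ k, σ k • InnerProductSpace.rankOne 𝕜 (u k) (v k)

variable (T : E →L[𝕜] F) (σ : ι → 𝕜) (u : ι → F) (v : ι → E)

theorem svdResidual_apply (x : E) :
    svdResidual T σ u v x = T x - ∑ k, (σ k * ⟪v k, x⟫_𝕜) • u k := by
  simp [svdResidual, smul_smul]

theorem svdResidual_apply_of_orthogonal {x : E} (hx : ∀ k, ⟪v k, x⟫_𝕜 = 0) :
    svdResidual T σ u v x = T x := by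
  simp [svdResidual_apply, hx]

variable {T} in
theorem isCompactOperator_svdResidual (hT : IsCompactOperator T) :
    IsCompactOperator (svdResidual T σ u v) := by
  have hrank (k) : InnerProductSpace.rankOne 𝕜 (u k) (v k) ∈ compactOperator (RingHom.id 𝕜) E F :=
    (isCompactOperator_of_locallyCompactSpace_dom (innerSL 𝕜 (v k))).clm_comp
      (.toSpanSingleton 𝕜 (u k))
  exact Submodule.sub_mem (compactOperator (RingHom.id 𝕜) E F) hT
    (Submodule.sum_mem _ fun k _ => Submodule.smul_mem _ _ (hrank k))

variable [CompleteSpace E] [CompleteSpace F]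

theorem adjoint_svdResidual :
    (svdResidual T σ u v)† = svdResidual (T†) (star σ) v u := by
  simp [svdResidual, map_smulₛₗ]

end Residual

variable [CompleteSpace E] [CompleteSpace F]

/-- A singular triplet `(σ, u, v)` of a bounded operator `T`: unit vectors `u`, `v` with `T v = σ u`
and `T† u = σ̄ v`. The phase of `σ` is free, as it may be moved into `u`. -/
structure IsOperatorSingularTriplet (T : E →L[𝕜] F) (σ : 𝕜) (u : F) (v : E) : Prop where
  norm_left : ‖u‖ = 1
  norm_right : ‖v‖ = 1
  apply_right : T v = σ • u
  apply_left : (T†) u = star σ • v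

namespace IsOperatorSingularTriplet

variable {T : E →L[𝕜] F} {σ : 𝕜} {u : F} {v : E}

theorem norm_apply_right (h : IsOperatorSingularTriplet T σ u v) : ‖T v‖ = ‖σ‖ := by
  rw [h.apply_right, norm_smul, h.norm_left, mul_one]

theorem norm_le_norm_svdResidual [Fintype ι] {σ' : ι → 𝕜} {u' : ι → F} {v' : ι → E}
    (h : IsOperatorSingularTriplet T σ u v) (hv : ∀ k, ⟪v' k, v⟫_𝕜 = 0) :
    ‖σ‖ ≤ ‖svdResidual T σ' u' v'‖ := by
  simpa [svdResidual_apply_of_orthogonal T σ' u' v' hv, h.norm_apply_right, h.norm_right]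
    using (svdResidual T σ' u' v').le_opNorm v

theorem of_svdResidual [Fintype ι] {σ' : ι → 𝕜} {u' : ι → F} {v' : ι → E}
    (h : IsOperatorSingularTriplet (svdResidual T σ' u' v') σ u v) (hu : ∀ k, ⟪u' k, u⟫_𝕜 = 0)
    (hv : ∀ k, ⟪v' k, v⟫_𝕜 = 0) : IsOperatorSingularTriplet T σ u v where
  norm_left := h.norm_left
  norm_right := h.norm_right
  apply_right := by rw [← h.apply_right, svdResidual_apply_of_orthogonal _ _ _ _ hv]
  apply_left := by
    rw [← h.apply_left, adjoint_svdResidual, svdResidual_apply_of_orthogonal _ _ _ _ hu]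

end IsOperatorSingularTriplet

theorem exists_norm_eq_one_apply_eq_smul_of_isCompactOperator {A : E →L[𝕜] E}
    (hA : IsCompactOperator A) (hAs : IsSelfAdjoint A) (hA0 : A ≠ 0) :
    ∃ (μ : 𝕜) (x : E), ‖μ‖ = ‖A‖ ∧ ‖x‖ = 1 ∧ A x = μ • x := by
  have hradius := A.spectralRadius_eq_nnnorm hAs
  have hne : (spectrum 𝕜 A).Nonempty := by
    by_contra! hempty
    exact hA0 (nnnorm_eq_zero.mp (by simpa [spectralRadius, hempty] using hradius.symm))
  obtain ⟨μ, hμ, hμA⟩ := spectrum.exists_nnnorm_eq_spectralRadius_of_nonempty hne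
  have hnorm : ‖μ‖ = ‖A‖ := congrArg NNReal.toReal (ENNReal.coe_injective (hμA.trans hradius))
  have hμ0 : μ ≠ 0 := norm_ne_zero_iff.mp (hnorm ▸ norm_ne_zero_iff.mpr hA0)
  obtain ⟨x, hx⟩ := ((hA.hasEigenvalue_iff_mem_spectrum hμ0).2 hμ).exists_hasEigenvector
  refine ⟨μ, (‖x‖⁻¹ : 𝕜) • x, hnorm, norm_smul_inv_norm hx.2, ?_⟩
  rw [map_smul, smul_comm μ]
  exact congrArg _ hx.apply_eq_smul

theorem exists_norm_eq_one_adjoint_apply_apply_eq_smul {T : E →L[𝕜] F} (hT : IsCompactOperator T)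
    (hT0 : T ≠ 0) :
    ∃ x : E, ‖x‖ = 1 ∧ ‖T x‖ = ‖T‖ ∧ (T†) (T x) = (‖T‖ : 𝕜) ^ 2 • x := by
  have hnorm : ‖(T†) ∘L T‖ = ‖T‖ ^ 2 := by rw [T.norm_adjoint_comp_self, sq]
  obtain ⟨μ, x, hμ, hx, hTx⟩ := exists_norm_eq_one_apply_eq_smul_of_isCompactOperator
    (hT.clm_comp (T†)) T.isPositive_adjoint_comp_self.isSelfAdjoint
    (T.adjoint_comp_self_eq_zero_iff.not.mpr hT0)
  rw [ContinuousLinearMap.comp_apply] at hTx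
  have hμ_eq : μ = (‖T x‖ : 𝕜) ^ 2 := by
    have h := T.adjoint_inner_right x (T x)
    rwa [hTx, inner_smul_right, inner_self_eq_norm_sq_to_K, inner_self_eq_norm_sq_to_K, hx,
      RCLike.ofReal_one, one_pow, mul_one] at h
  have hTx_norm : ‖T x‖ = ‖T‖ := by
    rw [hnorm, hμ_eq, norm_pow, RCLike.norm_ofReal, abs_norm] at hμ
    exact (pow_left_inj₀ (norm_nonneg _) (norm_nonneg _) two_ne_zero).mp hμ
  exact ⟨x, hx, hTx_norm, by rw [hTx, hμ_eq, hTx_norm]⟩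

theorem exists_isOperatorSingularTriplet_norm {T : E →L[𝕜] F} (hT : IsCompactOperator T)
    (hT0 : T ≠ 0) : ∃ u v, IsOperatorSingularTriplet T (‖T‖ : 𝕜) u v := by
  obtain ⟨v, hv, hTv, hadj⟩ := exists_norm_eq_one_adjoint_apply_apply_eq_smul hT hT0
  have hnorm : (‖T‖ : 𝕜) ≠ 0 := RCLike.ofReal_ne_zero.mpr (norm_ne_zero_iff.mpr hT0)
  have hTv0 : T v ≠ 0 := norm_ne_zero_iff.mp (hTv ▸ norm_ne_zero_iff.mpr hT0)
  refine ⟨(‖T‖⁻¹ : 𝕜) • T v, v, hTv ▸ norm_smul_inv_norm hTv0, hv,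
    (smul_inv_smul₀ hnorm _).symm, ?_⟩
  rw [map_smul, hadj, smul_smul, sq, inv_mul_cancel_left₀ hnorm, RCLike.star_def,
    RCLike.conj_ofReal]

section Residual

variable [Fintype ι] {T : E →L[𝕜] F} {σ : ι → 𝕜} {u : ι → F} {v : ι → E}

theorem inner_svdResidual_eq_zero (hu : Orthonormal 𝕜 u) (hT : ∀ k, (T†) (u k) = star (σ k) • v k)
    (k : ι) (x : E) : ⟪u k, svdResidual T σ u v x⟫_𝕜 = 0 := by
  classical
  rw [svdResidual_apply, inner_sub_right, ← T.adjoint_inner_left, hT, hu.inner_right_fintype,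
    inner_smul_left]
  simp

theorem exists_isOperatorSingularTriplet_norm_svdResidual_of_ne_zero (hT : IsCompactOperator T)
    (hu : Orthonormal 𝕜 u) (hv : Orthonormal 𝕜 v)
    (huv : ∀ k, IsOperatorSingularTriplet T (σ k) (u k) (v k)) (hS : svdResidual T σ u v ≠ 0) :
    ∃ f g, IsOperatorSingularTriplet T (‖svdResidual T σ u v‖ : 𝕜) f g ∧
      (∀ k, ⟪u k, f⟫_𝕜 = 0) ∧ ∀ k, ⟪v k, g⟫_𝕜 = 0 := by
  obtain ⟨f, g, hfg⟩ :=
    exists_isOperatorSingularTriplet_norm (isCompactOperator_svdResidual σ u v hT) hS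
  have hnorm : (‖svdResidual T σ u v‖ : 𝕜) ≠ 0 :=
    RCLike.ofReal_ne_zero.mpr (norm_ne_zero_iff.mpr hS)
  have hf (k) : ⟪u k, f⟫_𝕜 = 0 := by
    have h := inner_svdResidual_eq_zero hu (fun k => (huv k).apply_left) k g
    rw [hfg.apply_right, inner_smul_right] at h
    exact (mul_eq_zero.mp h).resolve_left hnorm
  have hg (k) : ⟪v k, g⟫_𝕜 = 0 := by
    have h := inner_svdResidual_eq_zero (T := T†) (σ := star σ) hv
      (fun k => by simpa using (huv k).apply_right) k f
    rw [← adjoint_svdResidual, hfg.apply_left, inner_smul_right] at h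
    exact (mul_eq_zero.mp h).resolve_left (star_ne_zero.mpr hnorm)
  exact ⟨f, g, hfg.of_svdResidual hf hg, hf, hg⟩

theorem exists_isOperatorSingularTriplet_norm_svdResidual (hE : ¬ FiniteDimensional 𝕜 E)
    (hF : ¬ FiniteDimensional 𝕜 F) (hT : IsCompactOperator T) (hu : Orthonormal 𝕜 u)
    (hv : Orthonormal 𝕜 v) (huv : ∀ k, IsOperatorSingularTriplet T (σ k) (u k) (v k)) :
    ∃ f g, IsOperatorSingularTriplet T (‖svdResidual T σ u v‖ : 𝕜) f g ∧
      (∀ k, ⟪u k, f⟫_𝕜 = 0) ∧ ∀ k, ⟪v k, g⟫_𝕜 = 0 := by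
  by_cases hS : svdResidual T σ u v = 0
  · obtain ⟨f, hf, huf⟩ := exists_norm_eq_one_forall_inner_eq_zero hF u
    obtain ⟨g, hg, hvg⟩ := exists_norm_eq_one_forall_inner_eq_zero hE v
    have hfg : IsOperatorSingularTriplet (svdResidual T σ u v) (‖svdResidual T σ u v‖ : 𝕜) f g :=
      ⟨hf, hg, by simp [hS], by simp [hS]⟩
    exact ⟨f, g, hfg.of_svdResidual huf hvg, huf, hvg⟩
  · exact exists_isOperatorSingularTriplet_norm_svdResidual_of_ne_zero hT hu hv huv hS

end Residual

/-- The operator counterpart of `IsLeadingSingularTriplets`: singular triplets of `T` with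
orthonormal left and right vectors, ordered by magnitude, and dominating every singular triplet
orthogonal to them. -/
structure IsLeadingOperatorSingularTriplets (T : E →L[𝕜] F) {m : ℕ} (σ : Fin m → 𝕜)
    (u : Fin m → F) (v : Fin m → E) : Prop where
  triplet : ∀ k, IsOperatorSingularTriplet T (σ k) (u k) (v k)
  orthonormal_left : Orthonormal 𝕜 u
  orthonormal_right : Orthonormal 𝕜 v
  antitone : Antitone fun k => ‖σ k‖
  leading : ∀ τ f g, IsOperatorSingularTriplet T τ f g →
    (∀ k, ⟪u k, f⟫_𝕜 = 0) → (∀ k, ⟪v k, g⟫_𝕜 = 0) → ∀ k, ‖τ‖ ≤ ‖σ k‖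

namespace IsLeadingOperatorSingularTriplets

variable {T : E →L[𝕜] F} {m : ℕ} {σ : Fin m → 𝕜} {u : Fin m → F} {v : Fin m → E}

theorem snoc (h : IsLeadingOperatorSingularTriplets T σ u v) {τ : 𝕜} {f : F} {g : E}
    (hfg : IsOperatorSingularTriplet T τ f g) (hf : ∀ k, ⟪u k, f⟫_𝕜 = 0)
    (hg : ∀ k, ⟪v k, g⟫_𝕜 = 0) (hτ : ‖svdResidual T σ u v‖ ≤ ‖τ‖) :
    IsLeadingOperatorSingularTriplets T (Fin.snoc σ τ : Fin (m + 1) → 𝕜)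
      (Fin.snoc u f : Fin (m + 1) → F) (Fin.snoc v g : Fin (m + 1) → E) where
  triplet := by simpa [Fin.forall_fin_succ'] using ⟨h.triplet, hfg⟩
  orthonormal_left := orthonormal_fin_snoc h.orthonormal_left hfg.norm_left hf
  orthonormal_right := orthonormal_fin_snoc h.orthonormal_right hfg.norm_right hg
  antitone := by
    have hlast := h.leading τ f g hfg hf hg
    have hmono : ∀ i j, i ≤ j → ‖σ j‖ ≤ ‖σ i‖ := fun i j hij => h.antitone hij
    simpa [Antitone, Fin.forall_fin_succ', Fin.le_last] using fun i => ⟨hmono i, hlast i⟩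
  leading t p q hpq hp hq := by
    simp only [Fin.forall_fin_succ', Fin.snoc_castSucc, Fin.snoc_last] at hp hq ⊢
    exact ⟨h.leading t p q hpq hp.1 hq.1, (hpq.norm_le_norm_svdResidual hq.1).trans hτ⟩

theorem succ_mul_norm_svdResidual_sq_le (h : IsLeadingOperatorSingularTriplets T σ u v) {C : ℝ}
    (hT : IsHilbertSchmidtBound T C) : (m + 1) * ‖svdResidual T σ u v‖ ^ 2 ≤ C ^ 2 := by
  by_cases hS : svdResidual T σ u v = 0
  · simpa [hS] using sq_nonneg C
  obtain ⟨f, g, hfg, hf, hg⟩ := exists_isOperatorSingularTriplet_norm_svdResidual_of_ne_zero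
    hT.isCompactOperator h.orthonormal_left h.orthonormal_right h.triplet hS
  set τ := ‖svdResidual T σ u v‖
  have hτ (k) : τ ≤ ‖σ k‖ := by simpa [τ] using h.leading _ f g hfg hf hg k
  calc (m + 1) * τ ^ 2 = ∑ _k : Fin m, τ ^ 2 + τ ^ 2 := by simp [add_mul]
    _ ≤ ∑ k, ‖σ k‖ ^ 2 + τ ^ 2 := by gcongr with k; exact hτ k
    _ = ∑ k, ‖T ((Fin.snoc v g : Fin (m + 1) → E) k)‖ ^ 2 := by
      simp [Fin.sum_univ_castSucc, hfg.norm_apply_right, (h.triplet _).norm_apply_right, τ]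
    _ ≤ C ^ 2 := hT _ (orthonormal_fin_snoc h.orthonormal_right hfg.norm_right hg)

theorem norm_svdResidual_lt (h : IsLeadingOperatorSingularTriplets T σ u v) {C c : ℝ}
    (hT : IsHilbertSchmidtBound T C) (hC : 0 < C) (hc : 0 < c) (hcm : c⁻¹ < m + 1) :
    ‖svdResidual T σ u v‖ < C * √c := by
  refine lt_of_pow_lt_pow_left₀ 2 (by positivity) ?_
  have hm : (0 : ℝ) < m + 1 := by positivity
  calc ‖svdResidual T σ u v‖ ^ 2
      ≤ C ^ 2 / (m + 1) := (le_div_iff₀' hm).mpr (h.succ_mul_norm_svdResidual_sq_le hT)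
    _ < C ^ 2 / c⁻¹ := by gcongr
    _ = (C * √c) ^ 2 := by rw [div_inv_eq_mul, mul_pow, Real.sq_sqrt hc.le]

end IsLeadingOperatorSingularTriplets

theorem exists_isLeadingOperatorSingularTriplets (hE : ¬ FiniteDimensional 𝕜 E)
    (hF : ¬ FiniteDimensional 𝕜 F) {T : E →L[𝕜] F} (hT : IsCompactOperator T) (m : ℕ) :
    ∃ (σ : Fin m → 𝕜) (u : Fin m → F) (v : Fin m → E),
      IsLeadingOperatorSingularTriplets T σ u v := by
  induction m with
  | zero =>
    exact ⟨Fin.elim0, Fin.elim0, Fin.elim0, (·.elim0), ⟨(·.elim0), (·.elim0)⟩,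
      ⟨(·.elim0), (·.elim0)⟩, (·.elim0), fun _ _ _ _ _ _ k => k.elim0⟩
  | succ m ih =>
    obtain ⟨σ, u, v, h⟩ := ih
    obtain ⟨f, g, hfg, hf, hg⟩ := exists_isOperatorSingularTriplet_norm_svdResidual hE hF hT
      h.orthonormal_left h.orthonormal_right h.triplet
    exact ⟨_, _, _, h.snoc hfg hf hg (by simp)⟩

end Operators

section L2Kernels

variable {X Y : Type*} {mX : MeasurableSpace X} {mY : MeasurableSpace Y} {μ : Measure X}
  {ν : Measure Y}

theorem inner_toLp_two {f g : X → ℝ} (hf : MemLp f 2 μ) (hg : MemLp g 2 μ) :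
    ⟪hf.toLp f, hg.toLp g⟫_ℝ = ∫ x, f x * g x ∂μ := by
  rw [L2.inner_def]
  refine integral_congr_ae ?_
  filter_upwards [hf.coeFn_toLp, hg.coeFn_toLp] with x hfx hgx
  rw [hfx, hgx, RCLike.inner_apply', conj_trivial]

theorem norm_toLp_two {f : X → ℝ} (hf : MemLp f 2 μ) : ‖hf.toLp f‖ = √(∫ x, f x ^ 2 ∂μ) := by
  simp only [norm_eq_sqrt_real_inner, inner_toLp_two, sq]

theorem Lp_eq_smul_iff_of_ae_eq {G : Type*} [NormedAddCommGroup G] [NormedSpace ℝ G] {p : ℝ≥0∞}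
    {f g : Lp G p μ} {F : X → G} (hf : f =ᵐ[μ] F) (c : ℝ) :
    f = c • g ↔ ∀ᵐ x ∂μ, F x = c • g x := by
  rw [Lp.ext_iff]
  exact ⟨fun h => hf.symm.trans (h.trans (Lp.coeFn_smul c g)),
    fun h => (hf.trans h).trans (Lp.coeFn_smul c g).symm⟩

theorem memLp_two_mul_prod {f : X → ℝ} {g : Y → ℝ} (hf : MemLp f 2 μ) (hg : MemLp g 2 ν) :
    MemLp (fun p : X × Y => f p.1 * g p.2) 2 (μ.prod ν) := by
  have hfg := hf.aestronglyMeasurable.comp_fst.mul (hg.aestronglyMeasurable.comp_snd (μ := μ))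
  refine (memLp_two_iff_integrable_sq hfg).mpr ?_
  simpa only [Pi.mul_apply, mul_pow] using hf.integrable_sq.mul_prod hg.integrable_sq

/-- The elementary tensor `(x, y) ↦ u x * v y` of two `L²` functions. -/
noncomputable def lpTensor (u : Lp ℝ 2 μ) (v : Lp ℝ 2 ν) : Lp ℝ 2 (μ.prod ν) :=
  (memLp_two_mul_prod (Lp.memLp u) (Lp.memLp v)).toLp _

theorem coeFn_lpTensor (u : Lp ℝ 2 μ) (v : Lp ℝ 2 ν) :
    lpTensor u v =ᵐ[μ.prod ν] fun p => u p.1 * v p.2 :=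
  MemLp.coeFn_toLp _

theorem inner_lpTensor_toLp (u : Lp ℝ 2 μ) (v : Lp ℝ 2 ν) {k : X × Y → ℝ}
    (hk : MemLp k 2 (μ.prod ν)) :
    ⟪lpTensor u v, hk.toLp k⟫_ℝ = ∫ p, u p.1 * v p.2 * k p ∂μ.prod ν :=
  inner_toLp_two _ hk

theorem add_lpTensor (u u' : Lp ℝ 2 μ) (v : Lp ℝ 2 ν) :
    lpTensor (u + u') v = lpTensor u v + lpTensor u' v := by
  have huv := memLp_two_mul_prod (Lp.memLp u) (Lp.memLp v)
  have huv' := memLp_two_mul_prod (Lp.memLp u') (Lp.memLp v)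
  refine (MemLp.toLp_congr _ (huv.add huv') ?_).trans (MemLp.toLp_add _ _)
  filter_upwards [Measure.quasiMeasurePreserving_fst.ae (Lp.coeFn_add u u')] with p hp
  simp only [hp, Pi.add_apply, add_mul]

theorem lpTensor_add (u : Lp ℝ 2 μ) (v v' : Lp ℝ 2 ν) :
    lpTensor u (v + v') = lpTensor u v + lpTensor u v' := by
  have huv := memLp_two_mul_prod (Lp.memLp u) (Lp.memLp v)
  have huv' := memLp_two_mul_prod (Lp.memLp u) (Lp.memLp v')
  refine (MemLp.toLp_congr _ (huv.add huv') ?_).trans (MemLp.toLp_add _ _)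
  filter_upwards [Measure.quasiMeasurePreserving_snd.ae (Lp.coeFn_add v v')] with p hp
  simp only [hp, Pi.add_apply, mul_add]

theorem smul_lpTensor (c : ℝ) (u : Lp ℝ 2 μ) (v : Lp ℝ 2 ν) :
    lpTensor (c • u) v = c • lpTensor u v := by
  have huv := memLp_two_mul_prod (Lp.memLp u) (Lp.memLp v)
  refine (MemLp.toLp_congr _ (huv.const_smul c) ?_).trans (MemLp.toLp_const_smul _ _)
  filter_upwards [Measure.quasiMeasurePreserving_fst.ae (Lp.coeFn_smul c u)] with p hp
  simp only [hp, Pi.smul_apply, smul_eq_mul, mul_assoc]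

theorem lpTensor_smul (c : ℝ) (u : Lp ℝ 2 μ) (v : Lp ℝ 2 ν) :
    lpTensor u (c • v) = c • lpTensor u v := by
  have huv := memLp_two_mul_prod (Lp.memLp u) (Lp.memLp v)
  refine (MemLp.toLp_congr _ (huv.const_smul c) ?_).trans (MemLp.toLp_const_smul _ _)
  filter_upwards [Measure.quasiMeasurePreserving_snd.ae (Lp.coeFn_smul c v)] with p hp
  simp only [hp, Pi.smul_apply, smul_eq_mul, mul_left_comm]

theorem lpTensor_indicatorConstLp_one {U : Set X} {V : Set Y} (hU : MeasurableSet U)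
    (hV : MeasurableSet V) (hμU : μ U ≠ ∞) (hνV : ν V ≠ ∞) (hUV : μ.prod ν (U ×ˢ V) ≠ ∞) :
    lpTensor (indicatorConstLp 2 hU hμU (1 : ℝ)) (indicatorConstLp 2 hV hνV (1 : ℝ)) =
      indicatorConstLp 2 (hU.prod hV) hUV (1 : ℝ) := by
  have hU_ae := Measure.quasiMeasurePreserving_fst (μ := μ) (ν := ν).ae
    (indicatorConstLp_coeFn (p := 2) (hs := hU) (hμs := hμU) (c := (1 : ℝ)))
  have hV_ae := Measure.quasiMeasurePreserving_snd (μ := μ) (ν := ν).ae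
    (indicatorConstLp_coeFn (p := 2) (hs := hV) (hμs := hνV) (c := (1 : ℝ)))
  refine Lp.ext ?_
  filter_upwards [coeFn_lpTensor _ _, hU_ae, hV_ae,
    indicatorConstLp_coeFn (p := 2) (hs := hU.prod hV) (hμs := hUV) (c := (1 : ℝ))]
    with p h hpU hpV hp
  rw [h, hp, hpU, hpV]
  exact Set.indicator_prod_one.symm

variable [SFinite μ] [SFinite ν]

theorem inner_lpTensor_lpTensor (u u' : Lp ℝ 2 μ) (v v' : Lp ℝ 2 ν) :
    ⟪lpTensor u v, lpTensor u' v'⟫_ℝ = ⟪u, u'⟫_ℝ * ⟪v, v'⟫_ℝ := by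
  have hmul (p : X × Y) : u p.1 * v p.2 * (u' p.1 * v' p.2) = u p.1 * u' p.1 * (v p.2 * v' p.2) :=
    mul_mul_mul_comm _ _ _ _
  rw [lpTensor, lpTensor, inner_toLp_two, L2.inner_def, L2.inner_def]
  simp only [RCLike.inner_apply', conj_trivial, hmul]
  exact integral_prod_mul (fun x => u x * u' x) fun y => v y * v' y

theorem norm_lpTensor (u : Lp ℝ 2 μ) (v : Lp ℝ 2 ν) : ‖lpTensor u v‖ = ‖u‖ * ‖v‖ := by
  rw [← sq_eq_sq₀ (norm_nonneg _) (by positivity), mul_pow]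
  simp only [← real_inner_self_eq_norm_sq, inner_lpTensor_lpTensor]

variable (μ ν) in
/-- `lpTensor` as a bounded bilinear map. -/
noncomputable def lpTensorL : Lp ℝ 2 μ →L[ℝ] Lp ℝ 2 ν →L[ℝ] Lp ℝ 2 (μ.prod ν) :=
  LinearMap.mkContinuous₂ (LinearMap.mk₂ ℝ (lpTensor : Lp ℝ 2 μ → Lp ℝ 2 ν → Lp ℝ 2 (μ.prod ν))
    add_lpTensor smul_lpTensor lpTensor_add lpTensor_smul) 1 fun u v => by
      rw [LinearMap.mk₂_apply, norm_lpTensor, one_mul]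

/-- The operator `v ↦ ∫ w (·, y) * v y ∂ν` with kernel `w`, in the weak form
`⟪u, kernelOperator w v⟫ = ⟪u ⊗ v, w⟫`, which makes sense of the integral for every `w ∈ L²`. -/
noncomputable def kernelOperator (w : Lp ℝ 2 (μ.prod ν)) : Lp ℝ 2 ν →L[ℝ] Lp ℝ 2 μ :=
  LinearMap.mkContinuous
    { toFun v := ((lpTensorL μ ν).flip v).adjoint w
      map_add' := by simp
      map_smul' := by simp }
    (‖(lpTensorL μ ν).flip‖ * ‖w‖) fun v => by
      rw [LinearMap.coe_mk, AddHom.coe_mk, mul_right_comm]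
      refine (ContinuousLinearMap.le_opNorm _ w).trans ?_
      rw [LinearIsometryEquiv.norm_map]
      gcongr
      exact ContinuousLinearMap.le_opNorm _ v

theorem inner_kernelOperator (w : Lp ℝ 2 (μ.prod ν)) (u : Lp ℝ 2 μ) (v : Lp ℝ 2 ν) :
    ⟪u, kernelOperator w v⟫_ℝ = ⟪lpTensor u v, w⟫_ℝ :=
  ((lpTensorL μ ν).flip v).adjoint_inner_right u w

theorem isHilbertSchmidtBound_kernelOperator (w : Lp ℝ 2 (μ.prod ν)) :
    IsHilbertSchmidtBound (kernelOperator w) ‖w‖ := by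
  intro n e he
  set T := kernelOperator w
  set g : Lp ℝ 2 (μ.prod ν) := ∑ i, lpTensor (T (e i)) (e i)
  have hgw : ⟪g, w⟫_ℝ = ∑ i, ‖T (e i)‖ ^ 2 := by
    simp [g, T, sum_inner, ← inner_kernelOperator]
  have hgg : ‖g‖ ^ 2 = ∑ i, ‖T (e i)‖ ^ 2 := by
    rw [← real_inner_self_eq_norm_sq]
    simp only [g, sum_inner, inner_sum, inner_lpTensor_lpTensor, orthonormal_iff_ite.mp he,
      mul_ite, mul_one, mul_zero, Finset.sum_ite_eq', Finset.mem_univ, if_true,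
      real_inner_self_eq_norm_sq]
  have hle : ‖g‖ ≤ ‖w‖ := by
    rcases (norm_nonneg g).eq_or_lt with hg | hg
    · exact hg ▸ norm_nonneg w
    · refine le_of_mul_le_mul_left ?_ hg
      rw [← sq, hgg, ← hgw]
      exact real_inner_le_norm g w
  rw [← hgg]
  gcongr

theorem svdResidual_kernelOperator {ι : Type*} [Fintype ι] (w : Lp ℝ 2 (μ.prod ν)) (σ : ι → ℝ)
    (u : ι → Lp ℝ 2 μ) (v : ι → Lp ℝ 2 ν) :
    svdResidual (kernelOperator w) σ u v =
      kernelOperator (w - ∑ k, σ k • lpTensor (u k) (v k)) := by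
  ext1 y
  refine ext_inner_left ℝ fun x => ?_
  rw [svdResidual_apply, inner_sub_right, inner_kernelOperator, inner_kernelOperator,
    inner_sub_right, inner_sum, inner_sum]
  congr 1
  refine Finset.sum_congr rfl fun k _ => ?_
  rw [real_inner_smul_right, real_inner_smul_right, inner_lpTensor_lpTensor,
    real_inner_comm y (v k)]
  ring

theorem adjoint_kernelOperator_toLp {k : X × Y → ℝ} (hk : MemLp k 2 (μ.prod ν)) :
    (kernelOperator (hk.toLp k))† = kernelOperator
      ((hk.comp_measurePreserving Measure.measurePreserving_swap).toLp (k ∘ Prod.swap)) := by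
  symm
  rw [ContinuousLinearMap.eq_adjoint_iff]
  intro u v
  rw [real_inner_comm, inner_kernelOperator, inner_kernelOperator, inner_lpTensor_toLp,
    inner_lpTensor_toLp, ← integral_prod_swap]
  simp only [Function.comp_apply, Prod.fst_swap, Prod.snd_swap, Prod.swap_swap, mul_comm]

theorem setIntegral_kernelOperator_toLp {k : X × Y → ℝ} (hk : MemLp k 2 (μ.prod ν))
    (v : Lp ℝ 2 ν) {s : Set X} (hs : MeasurableSet s) (hμs : μ s ≠ ∞) :
    ∫ x in s, kernelOperator (hk.toLp k) v x ∂μ =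
      ∫ p, s.indicator 1 p.1 * v p.2 * k p ∂μ.prod ν := by
  rw [← L2.inner_indicatorConstLp_one (𝕜 := ℝ) hs hμs, inner_kernelOperator, inner_lpTensor_toLp]
  refine integral_congr_ae ?_
  filter_upwards [Measure.quasiMeasurePreserving_fst.ae
    (indicatorConstLp_coeFn (p := 2) (hs := hs) (hμs := hμs) (c := (1 : ℝ)))] with p hp
  rw [hp]
  rfl

theorem coeFn_kernelOperator_toLp [SigmaFinite μ] {k : X × Y → ℝ} (hk : MemLp k 2 (μ.prod ν))
    (v : Lp ℝ 2 ν) :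
    kernelOperator (hk.toLp k) v =ᵐ[μ] fun x => ∫ y, k (x, y) * v y ∂ν := by
  have hint {s : Set X} (hs : MeasurableSet s) (hμs : μ s ≠ ∞) :
      Integrable (fun p => s.indicator 1 p.1 * v p.2 * k p) (μ.prod ν) :=
    (memLp_two_mul_prod (memLp_indicator_const 2 hs (1 : ℝ) (.inr hμs)) (Lp.memLp v)).integrable_mul
      hk
  have hinner (s : Set X) (x : X) : ∫ y, s.indicator 1 x * v y * k (x, y) ∂ν =
      s.indicator (fun x => ∫ y, k (x, y) * v y ∂ν) x := by
    by_cases hx : x ∈ s <;> simp [hx, mul_comm]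
  refine ae_eq_of_forall_setIntegral_eq_of_sigmaFinite
    (fun s _ hμs => integrableOn_Lp_of_measure_ne_top _ one_le_two hμs.ne)
    (fun s hs hμs => ?_) fun s hs hμs => ?_
  · rw [← integrable_indicator_iff hs]
    exact (hint hs hμs.ne).integral_prod_left.congr (.of_forall (hinner s))
  · rw [setIntegral_kernelOperator_toLp hk v hs hμs.ne, integral_prod _ (hint hs hμs.ne),
      ← integral_indicator hs]
    simp only [hinner]

theorem abs_setIntegral_prod_le (w : Lp ℝ 2 (μ.prod ν)) {U : Set X} {V : Set Y}
    (hU : MeasurableSet U) (hV : MeasurableSet V) (hμU : μ U ≠ ∞) (hνV : ν V ≠ ∞) :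
    |∫ p in U ×ˢ V, w p ∂μ.prod ν| ≤ √(μ.real U) * √(ν.real V) * ‖kernelOperator w‖ := by
  have hUV : μ.prod ν (U ×ˢ V) ≠ ∞ := by
    rw [Measure.prod_prod]
    exact ENNReal.mul_ne_top hμU hνV
  set f : Lp ℝ 2 μ := indicatorConstLp 2 hU hμU 1
  set g : Lp ℝ 2 ν := indicatorConstLp 2 hV hνV 1
  have hf : ‖f‖ = √(μ.real U) := by
    simp [f, norm_indicatorConstLp, Real.sqrt_eq_rpow]
  have hg : ‖g‖ = √(ν.real V) := by
    simp [g, norm_indicatorConstLp, Real.sqrt_eq_rpow]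
  calc |∫ p in U ×ˢ V, w p ∂μ.prod ν| = |⟪f, kernelOperator w g⟫_ℝ| := by
        rw [inner_kernelOperator, lpTensor_indicatorConstLp_one hU hV hμU hνV hUV,
          L2.inner_indicatorConstLp_one]
    _ ≤ ‖f‖ * ‖kernelOperator w g‖ := abs_real_inner_le_norm _ _
    _ ≤ ‖f‖ * (‖kernelOperator w‖ * ‖g‖) := by gcongr; exact ContinuousLinearMap.le_opNorm _ _
    _ = √(μ.real U) * √(ν.real V) * ‖kernelOperator w‖ := by rw [hf, hg]; ring

end L2Kernels

theorem not_finiteDimensional_Lp_of_compact {s : Set ℝ} [CompactSpace s] (ρ : Measure s)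
    [IsFiniteMeasure ρ] [NullSingletonClass ρ] [NeZero ρ] (p : ℝ≥0∞) [Fact (1 ≤ p)] :
    ¬ FiniteDimensional ℝ (Lp ℝ p ρ) := by
  intro hfd
  let φ : Polynomial ℝ →ₗ[ℝ] Lp ℝ p ρ := (ContinuousMap.toLp (E := ℝ) p ρ ℝ).toLinearMap ∘ₗ
    (Polynomial.toContinuousMapOnAlgHom s).toLinearMap
  have hφ : Function.Injective φ := (injective_iff_map_eq_zero φ).mpr fun q hq => by
    by_contra hq0
    have hfin : {x : s | q.eval (x : ℝ) = 0}.Finite :=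
      (Polynomial.finite_setOfPred_isRoot hq0).preimage Subtype.val_injective.injOn
    have hq_ae : φ q =ᵐ[ρ] fun x => q.eval (x : ℝ) :=
      ContinuousMap.coeFn_toLp (p := p) (𝕜 := ℝ) ρ (Polynomial.toContinuousMapOnAlgHom s q)
    rw [hq] at hq_ae
    have hroot : ∀ᵐ x : s ∂ρ, q.eval (x : ℝ) = 0 := hq_ae.symm.trans (Lp.coeFn_zero _ _ _)
    have hnot : ∀ᵐ x : s ∂ρ, q.eval (x : ℝ) ≠ 0 := by simpa [ae_iff] using hfin.measure_zero ρ
    obtain ⟨x, hx, hx'⟩ := (hroot.and hnot).exists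
    exact hx' hx
  exact Polynomial.not_finite (R := ℝ) (Module.Finite.of_injective φ hφ)

namespace Graphon

variable (W : Graphon)

theorem memLp : MemLp W.toFun 2 (volume.prod volume) :=
  MemLp.of_bound W.measurable_toFun.aestronglyMeasurable 1 (.of_forall fun p => by
    rw [Real.norm_of_nonneg (W.mem_Icc p).1]
    exact (W.mem_Icc p).2)

/-- The integral operator `v ↦ ∫ W(·, y) v(y) dy` on `L²[0,1]`. -/
noncomputable def integralOperator : L2I →L[ℝ] L2I := kernelOperator (W.memLp.toLp W.toFun)

theorem coeFn_integralOperator (v : L2I) :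
    W.integralOperator v =ᵐ[volume] fun x => ∫ y, W.toFun (x, y) * v y :=
  coeFn_kernelOperator_toLp W.memLp v

theorem coeFn_adjoint_integralOperator (u : L2I) :
    (W.integralOperator†) u =ᵐ[volume] fun y => ∫ x, W.toFun (x, y) * u x := by
  rw [integralOperator, adjoint_kernelOperator_toLp]
  exact coeFn_kernelOperator_toLp _ u

theorem isHilbertSchmidtBound_integralOperator :
    IsHilbertSchmidtBound W.integralOperator (frobeniusNorm W.toFun) := by
  have h := isHilbertSchmidtBound_kernelOperator (W.memLp.toLp W.toFun)
  rwa [norm_toLp_two] at h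

theorem frobeniusNorm_pos (hW : ¬ W.toFun =ᵐ[volume] 0) : 0 < frobeniusNorm W.toFun := by
  refine (Real.sqrt_nonneg _).lt_of_ne' fun h => hW ?_
  have hzero : W.memLp.toLp W.toFun = 0 := norm_eq_zero.mp ((norm_toLp_two W.memLp).trans h)
  exact W.memLp.coeFn_toLp.symm.trans ((Lp.ext_iff.mp hzero).trans (Lp.coeFn_zero _ _ _))

variable {W}

theorem isSingularTriplet_iff {σ : ℝ} {u v : L2I} :
    IsSingularTriplet W σ u v ↔ IsOperatorSingularTriplet W.integralOperator σ u v := by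
  have hright := Lp_eq_smul_iff_of_ae_eq (g := u) (W.coeFn_integralOperator v) σ
  have hleft := Lp_eq_smul_iff_of_ae_eq (g := v) (W.coeFn_adjoint_integralOperator u) σ
  exact ⟨fun h => ⟨h.1, h.2, hright.mpr h.3, hleft.mpr h.4⟩,
    fun h => ⟨h.1, h.2, hright.mp h.3, hleft.mp h.4⟩⟩

theorem isLeadingSingularTriplets_iff {m : ℕ} {σ : Fin m → ℝ} {u v : Fin m → L2I} :
    IsLeadingSingularTriplets W σ u v ↔
      IsLeadingOperatorSingularTriplets W.integralOperator σ u v := by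
  constructor <;> rintro ⟨triplet, left, right, antitone, leading⟩
  · exact ⟨fun k => isSingularTriplet_iff.mp (triplet k), left, right,
      fun i j hij => antitone i j hij,
      fun τ f g hfg => leading τ f g (isSingularTriplet_iff.mpr hfg)⟩
  · exact ⟨fun k => isSingularTriplet_iff.mpr (triplet k), left, right,
      fun i j hij => antitone hij,
      fun τ f g hfg => leading τ f g (isSingularTriplet_iff.mp hfg)⟩

variable (W) {m : ℕ} (σ : Fin m → ℝ) (u v : Fin m → L2I)

theorem coeFn_toLp_sub_sum_lpTensor :
    (W.memLp.toLp W.toFun - ∑ k, σ k • lpTensor (u k) (v k) : Lp ℝ 2 (volume.prod volume))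
      =ᵐ[volume.prod volume] fun p => W.toFun p - svdKernel σ u v p := by
  have hterm (k) : (σ k • lpTensor (u k) (v k) : Lp ℝ 2 (volume.prod volume))
      =ᵐ[volume.prod volume] fun p => σ k * u k p.1 * v k p.2 := by
    filter_upwards [Lp.coeFn_smul (σ k) (lpTensor (u k) (v k)), coeFn_lpTensor (u k) (v k)]
      with p hsmul htensor
    rw [hsmul, Pi.smul_apply, htensor, smul_eq_mul, mul_assoc]
  refine (Lp.coeFn_sub _ _).trans (W.memLp.coeFn_toLp.sub ((Lp.coeFn_finsetSum _ _).trans ?_))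
  filter_upwards [Filter.eventually_all.mpr hterm] with p hp
  simp only [Finset.sum_apply, hp, svdKernel]

theorem cutNorm_sub_svdKernel_le :
    cutNorm (fun p => W.toFun p - svdKernel σ u v p) ≤ ‖svdResidual W.integralOperator σ u v‖ := by
  refine Real.sSup_le ?_ (norm_nonneg _)
  rintro _ ⟨U, V, hU, hV, rfl⟩
  rw [integralOperator, svdResidual_kernelOperator, Measure.volume_eq_prod,
    ← integral_congr_ae (ae_restrict_of_ae (W.coeFn_toLp_sub_sum_lpTensor σ u v))]
  refine (abs_setIntegral_prod_le _ hU hV (measure_ne_top _ U) (measure_ne_top _ V)).trans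
    (mul_le_of_le_one_left (norm_nonneg _) (mul_le_one₀ ?_ (Real.sqrt_nonneg _) ?_))
  all_goals exact Real.sqrt_le_one.mpr measureReal_le_one

end Graphon

theorem one_sub_div_le_uniformOn_Icc_real {K : ℕ} (hK : 1 ≤ K) {t : ℝ} (ht : 0 ≤ t) {A : Set ℕ}
    (hA : ∀ m : ℕ, t < m + 1 → m ∈ A) : 1 - t / K ≤ (uniformOn (Set.Icc 1 K)).real A := by
  have : IsProbabilityMeasure (uniformOn (Set.Icc 1 K)) :=
    isProbabilityMeasure_uniformOn (Set.finite_Icc 1 K) ⟨1, le_rfl, hK⟩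
  have hcompl : Aᶜ ⊆ (Finset.range ⌊t⌋₊ : Set ℕ) := fun m hm => by
    have hmt : (m + 1 : ℝ) ≤ t := not_lt.mp (mt (hA m) hm)
    exact Finset.mem_coe.mpr (Finset.mem_range.mpr (Nat.le_floor (by exact_mod_cast hmt)))
  have hcard : ((Finset.Icc 1 K ∩ Finset.range ⌊t⌋₊).card : ℝ) ≤ t :=
    (Nat.cast_le.mpr ((Finset.card_le_card Finset.inter_subset_right).trans
      (Finset.card_range _).le)).trans (Nat.floor_le ht)
  have hprob : (uniformOn (Set.Icc 1 K)).real Aᶜ ≤ t / K := by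
    refine (measureReal_mono hcompl).trans ?_
    rw [measureReal_def, ← Finset.coe_Icc, uniformOn_apply_finset, Nat.card_Icc,
      Nat.add_sub_cancel, ENNReal.toReal_div, ENNReal.toReal_natCast, ENNReal.toReal_natCast]
    gcongr
  rw [probReal_compl_eq_one_sub .of_discrete] at hprob
  linarith

theorem mainTheorem7_general {𝕜 E F : Type*} [RCLike 𝕜] [NormedAddCommGroup E]
    [InnerProductSpace 𝕜 E] [CompleteSpace E] [NormedAddCommGroup F] [InnerProductSpace 𝕜 F]
    [CompleteSpace F] (hE : ¬ FiniteDimensional 𝕜 E) (hF : ¬ FiniteDimensional 𝕜 F)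
    {T : E →L[𝕜] F} {C : ℝ} (hT : IsHilbertSchmidtBound T C) (hC : 0 < C) {K : ℕ} (hK : 1 ≤ K)
    {R : ℝ} (hR : 0 < R) :
    (∀ m : ℕ, ∃ (σ : Fin m → 𝕜) (u : Fin m → F) (v : Fin m → E),
      IsLeadingOperatorSingularTriplets T σ u v) ∧
    1 - 1 / R ≤ (uniformOn (Set.Icc 1 K)).real
      {m : ℕ | ∀ (σ : Fin m → 𝕜) (u : Fin m → F) (v : Fin m → E),
        IsLeadingOperatorSingularTriplets T σ u v → ‖svdResidual T σ u v‖ < C * √(R / K)} := by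
  refine ⟨exists_isLeadingOperatorSingularTriplets hE hF hT.isCompactOperator, ?_⟩
  have hK0 : (0 : ℝ) < K := by exact_mod_cast hK
  have hKR : K / R / K = 1 / R := by field_simp
  rw [← hKR]
  refine one_sub_div_le_uniformOn_Icc_real hK (by positivity) fun m hm σ u v h => ?_
  exact h.norm_svdResidual_lt hT hC (div_pos hR hK0) (by rwa [inv_div])

theorem mainTheorem7 (W : Graphon) (hW : ¬ W.toFun =ᵐ[volume] 0)
    (K : ℕ) (hK : 1 ≤ K) (R : ℝ) (hR : 1 ≤ R) (hKR : ∃ n : ℕ, (K : ℝ) / R = n) :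
    (∀ m : ℕ, ∃ (σ : Fin m → ℝ) (u v : Fin m → L2I), IsLeadingSingularTriplets W σ u v) ∧
    1 - 1 / R ≤ (uniformOn (Set.Icc 1 K)).real
      {m : ℕ | ∀ (σ : Fin m → ℝ) (u v : Fin m → L2I), IsLeadingSingularTriplets W σ u v →
        cutNorm (fun p => W.toFun p - svdKernel σ u v p) <
          frobeniusNorm W.toFun * Real.sqrt (R / K)} := by
  have hL2I : ¬ FiniteDimensional ℝ L2I := not_finiteDimensional_Lp_of_compact _ 2
  obtain ⟨hexists, hprob⟩ := mainTheorem7_general hL2I hL2I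
    W.isHilbertSchmidtBound_integralOperator (W.frobeniusNorm_pos hW) hK (zero_lt_one.trans_le hR)
  simp only [Graphon.isLeadingSingularTriplets_iff]
  exact ⟨hexists, hprob.trans (measureReal_mono fun m hm σ u v h =>
    (W.cutNorm_sub_svdKernel_le σ u v).trans_lt (hm σ u v h))⟩
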